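/- Let $k$ be a field and let $K$ be an extension field of $k$ with infinitely many elements ($K=k$ is allowed when $k$ is infinite). Let $G$ be a finite simple graph with vertex set $\{x_1,\dots,x_n\}$, let $R=k[x_1,\dots,x_n]$, let $I(G)=\langle x_ix_j : \{x_i,x_j\}\in E(G)\rangle\subseteq R$ be its edge ideal, and let $W_1,\dots,W_m$ be all the minimal vertex covers of $G$. For an ideal $I$ of a polynomial ring over $k$ let $\mathcal V(I)$ be its set of common zeros with coordinates in $K$, and for a set $S$ of points with coordinates in $K$ let $\mathcal I(S)$ be the ideal of the polynomials over $k$ that vanish on $S$; the Zariski closure of $S$ is $\overline S=\mathcal V(\mathcal I(S))$. For an integer $s\ge 0$ let $\mathcal J_s(R)=k[x_i^{(l)} : 1\le i\le n,\ 0\le l\le s]$, and for an ideal $I\subseteq R$ let $\mathcal J_s(I)\subseteq\mathcal J_s(R)$ be the ideal generated by the coefficients of $t^0,\dots,t^s$ in $f\bigl(\sum_{l=0}^s x_1^{(l)}t^l,\dots,\sum_{l=0}^s x_n^{(l)}t^l\bigr)$ for $f\in I$. For a set $W$ of vertices let $\mathcal J_s(W)=\{x_i^{(l)} : x_i\in W,\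 0\le l\le s\}$. Let $X=\mathcal V(I(G))\subseteq K^n$. A point $p\in X$ is smooth if the tangent space $T_pX=\{v\in K^n : \sum_i \frac{\partial f}{\partial x_i}(p)\,v_i=0 \text{ for all } f\in\mathcal I(X)\}$ has dimension $\dim_pX$, the largest dimension of an irreducible component of $X$ through $p$ (the dimension of a component $F$ being the Krull dimension of $R/\mathcal I(F)$). Let $X_{\mathrm{smooth}}$ be the set of smooth points of $X$, and let $\mathcal J_s(X_{\mathrm{smooth}})$ be the set of $s$-jets of $X$ based at smooth points, that is, of the points of $\mathcal V(\mathcal J_s(I(G)))$ whose coordinates $(x_1^{(0)},\dots,x_n^{(0)})$ form a point of $X_{\mathrm{smooth}}$. The $s$-order principal component of $G$ is the Zariski closure $\overline{\mathcal J_s(X_{\mathrm{smooth}})}$ in $K^{n(s+1)}$. Then $$\overline{\mathcal J_s(X_{\mathrm{smooth}})}=\mathcal V(\langle\mathcal J_s(W_1)\rangle)\cup\dots\cup\mathcal V(\langle\mathcal J_s(W_m)\rangle).$$ -/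

import Mathlib

open MvPolynomial

noncomputable section

namespace GraphJets

/-! ### Affine varieties

`k` is the field of coefficients and `K` an extension field of `k` in which points have their
coordinates; the affine space is `σ → K`. The choice `K = k` is allowed. The zero set of an ideal
and the ideal of a set of points are Mathlib's `MvPolynomial.zeroLocus` and
`MvPolynomial.vanishingIdeal`. -/

/-- The Zariski closure of a set of points: the smallest zero set of an ideal of `k[σ]` that
contains it. -/
def zariskiClosure (k : Type*) {K σ : Type*} [Field k] [Field K] [Algebra k K]
    (S : Set (σ → K)) : Set (σ → K) :=
  zeroLocus K (vanishingIdeal k S)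

/-- The Zariski closed subsets of affine space. -/
def IsVariety (k : Type*) {K σ : Type*} [Field k] [Field K] [Algebra k K]
    (Z : Set (σ → K)) : Prop :=
  ∃ I : Ideal (MvPolynomial σ k), Z = zeroLocus K I

/-- A nonempty variety that is not the union of two strictly smaller varieties. -/
def IsIrreducibleVariety (k : Type*) {K σ : Type*} [Field k] [Field K] [Algebra k K]
    (Z : Set (σ → K)) : Prop :=
  IsVariety k Z ∧ Z.Nonempty ∧
    ∀ Z₁ Z₂ : Set (σ → K), IsVariety k Z₁ → IsVariety k Z₂ → Z = Z₁ ∪ Z₂ → Z = Z₁ ∨ Z = Z₂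

/-- `F` is an irreducible component of `X`. -/
def IsComponent (k : Type*) {K σ : Type*} [Field k] [Field K] [Algebra k K]
    (X F : Set (σ → K)) : Prop :=
  Maximal (fun Z => IsIrreducibleVariety k Z ∧ Z ⊆ X) F

/-- The dimension of a variety: the Krull dimension of its coordinate ring. -/
def varietyDim (k : Type*) {K σ : Type*} [Field k] [Field K] [Algebra k K]
    (Z : Set (σ → K)) : WithBot ℕ∞ :=
  ringKrullDim (MvPolynomial σ k ⧸ vanishingIdeal k Z)

/-- The dimension of `X` at `p`: the largest dimension of an irreducible component of `X`
through `p`. -/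
def dimAt (k : Type*) {K σ : Type*} [Field k] [Field K] [Algebra k K]
    (X : Set (σ → K)) (p : σ → K) : WithBot ℕ∞ :=
  ⨆ F ∈ {F : Set (σ → K) | IsComponent k X F ∧ p ∈ F}, varietyDim k F

/-- The tangent space of `X` at `p`, translated to the origin: the common kernel of the
differentials at `p` of the polynomials that vanish on `X`. -/
def tangentSpace (k : Type*) {K σ : Type*} [Field k] [Field K] [Algebra k K] [Fintype σ]
    (X : Set (σ → K)) (p : σ → K) : Submodule K (σ → K) where
  carrier := {v | ∀ f ∈ vanishingIdeal k X, ∑ i, aeval p (pderiv i f) * v i = 0}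
  zero_mem' := by
    intro f _
    simp
  add_mem' := by
    intro v w hv hw f hf
    simp [mul_add, Finset.sum_add_distrib, hv f hf, hw f hf]
  smul_mem' := by
    intro c v hv f hf
    have h := hv f hf
    simp only [Pi.smul_apply, smul_eq_mul, mul_left_comm _ c, ← Finset.mul_sum, h, mul_zero]

/-- The smooth locus of `X`: the points of `X` at which the tangent space has the dimension
of `X` at that point. -/
def smoothLocus (k : Type*) {K σ : Type*} [Field k] [Field K] [Algebra k K] [Fintype σ]
    (X : Set (σ → K)) : Set (σ → K) :=
  {p | p ∈ X ∧ (Module.finrank K (tangentSpace k X p) : WithBot ℕ∞) = dimAt k X p}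

/-! ### Jets

The variable `x_i^{(l)}` of the jet ring is `X (i, l)`, with `l` in `{0, …, s}`. -/

/-- The homomorphism `x_i ↦ x_i^{(0)} + x_i^{(1)} t + ⋯ + x_i^{(s)} t^s`. Its target is the
polynomial ring in `t` over the jet ring; passing to the truncation modulo `t^{s+1}` amounts to
keeping the coefficients of `t^0, …, t^s` only. -/
def jetHom (k σ : Type*) [Field k] (s : ℕ) :
    MvPolynomial σ k →ₐ[k] Polynomial (MvPolynomial (σ × Fin (s + 1)) k) :=
  aeval fun i => ∑ l : Fin (s + 1), Polynomial.monomial (l : ℕ) (X (i, l))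

/-- The ideal of `s`-jets of an ideal `I`: it is generated by the coefficients of
`t^0, …, t^s` in the images of the elements of `I`. -/
def jetIdeal {k σ : Type*} [Field k] (s : ℕ) (I : Ideal (MvPolynomial σ k)) :
    Ideal (MvPolynomial (σ × Fin (s + 1)) k) :=
  Ideal.span {g | ∃ f ∈ I, ∃ l : Fin (s + 1), g = (jetHom k σ s f).coeff (l : ℕ)}

/-- The projection from `s`-jets to their base points. -/
def jetProj {K σ : Type*} (s : ℕ) (P : σ × Fin (s + 1) → K) : σ → K :=
  fun i => P (i, 0)

/-- The `s`-jets of an open subset `U` of the variety of `I`: the `s`-jets of the variety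
whose base point lies in `U`. -/
def jetsOfOpen {k K σ : Type*} [Field k] [Field K] [Algebra k K] (s : ℕ)
    (I : Ideal (MvPolynomial σ k)) (U : Set (σ → K)) : Set (σ × Fin (s + 1) → K) :=
  {P | P ∈ zeroLocus K (jetIdeal s I) ∧ jetProj s P ∈ U}

/-! ### Graphs -/

/-- The edge ideal of a graph, generated by the products `x * y` over the edges `{x, y}`. -/
def edgeIdeal (k : Type*) {V : Type*} [Field k] (G : SimpleGraph V) :
    Ideal (MvPolynomial V k) :=
  Ideal.span {f | ∃ x y : V, G.Adj x y ∧ f = X x * X y}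

/-- The set of jet variables `x^{(l)}`, `0 ≤ l ≤ s`, of the vertices `x` in `W`. -/
def jetVars (k : Type*) {V : Type*} [Field k] (s : ℕ) (W : Set V) :
    Set (MvPolynomial (V × Fin (s + 1)) k) :=
  {f | ∃ x ∈ W, ∃ l : Fin (s + 1), f = X (x, l)}

/-- The `s`-order principal component of a graph: the Zariski closure of the `s`-jets of the
smooth locus of the variety of its edge ideal. -/
def principalComponent (k K : Type*) {V : Type*} [Field k] [Field K] [Algebra k K] [Fintype V]
    (s : ℕ) (G : SimpleGraph V) : Set (V × Fin (s + 1) → K) :=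
  zariskiClosure k
    (jetsOfOpen s (edgeIdeal k G) (smoothLocus k (zeroLocus K (edgeIdeal k G))))

end GraphJets

end

open MvPolynomial

noncomputable section

namespace GraphJets

/-! ### Coordinate subspaces -/

section CoordSubspace

variable {k K σ : Type*} [Field k] [Field K] [Algebra k K]

/-! The variety `X` of the edge ideal is a union of coordinate subspaces, and its components are
those of the minimal vertex covers (`isComponent_zeroLocus_edgeIdeal_iff`); `K` being infinite makes
their vanishing ideals prime. At a smooth point the tangent space equals the largest component
through it, given by a cover `W`, and every vertex of `W` then has a neighbour whose coordinate is
nonzero (`exists_minimal_of_mem_smoothLocus`). That neighbour's series is a unit modulo `t ^ (s +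
1)`, so the edge equation kills the whole series of the vertex: the jet lies in the linear space of
`W`. A finite union of such spaces is closed. Conversely, a point vanishing exactly on a minimal
cover `W` is smooth. The jets over such points that lie in the linear space of `W` are the
complement of a hypersurface there, hence dense by primality. -/

/-- The linear subspace of affine space on which the coordinates in `W` vanish. -/
def coordSubspace (K : Type*) {σ : Type*} [Field K] (W : Set σ) : Submodule K (σ → K) where
  carrier := {v | ∀ i ∈ W, v i = 0}
  zero_mem' _ _ := rfl
  add_mem' hv hw i hi := by simp [hv i hi, hw i hi]
  smul_mem' c v hv i hi := by simp [hv i hi]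

theorem mem_coordSubspace {W : Set σ} {v : σ → K} :
    v ∈ coordSubspace K W ↔ ∀ i ∈ W, v i = 0 :=
  Iff.rfl

theorem coordSubspace_le_iff {W W' : Set σ} :
    coordSubspace K W ≤ coordSubspace K W' ↔ W' ⊆ W := by
  classical
  refine ⟨fun h i hi => ?_, fun h v hv i hi => hv i (h hi)⟩
  by_contra hiW
  have : Pi.single i (1 : K) ∈ coordSubspace K W' :=
    h fun j hj => Pi.single_eq_of_ne (by rintro rfl; exact hiW hj) _
  simpa using this i hi

/-- Restriction to the coordinates outside `W` identifies the coordinate subspace with an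
affine space. -/
def coordSubspaceEquiv (K : Type*) {σ : Type*} [Field K] (W : Set σ) :
    coordSubspace K W ≃ₗ[K] ((Wᶜ : Set σ) → K) := by
  classical
  exact
  { toFun := fun v i => v.1 i
    map_add' := fun _ _ => rfl
    map_smul' := fun _ _ => rfl
    invFun := fun y => ⟨fun i => if h : i ∈ Wᶜ then y ⟨i, h⟩ else 0,
      fun i hi => dif_neg fun h => h hi⟩
    left_inv := fun v => by
      ext i
      by_cases h : i ∈ W
      · simp [h, v.2 i h]
      · simp [h]
    right_inv := fun y => by
      ext i
      simp }

theorem finrank_coordSubspace [Finite σ] (W : Set σ) :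
    Module.finrank K (coordSubspace K W) = Nat.card (Wᶜ : Set σ) := by
  have := Fintype.ofFinite (Wᶜ : Set σ)
  rw [(coordSubspaceEquiv K W).finrank_eq, Module.finrank_pi, Nat.card_eq_fintype_card]

theorem zeroLocus_span_X (W : Set σ) :
    zeroLocus K (Ideal.span ((X : σ → MvPolynomial σ k) '' W)) = coordSubspace K W := by
  ext v
  simp [zeroLocus_span, mem_coordSubspace]

theorem isVariety_coordSubspace (W : Set σ) :
    IsVariety k (coordSubspace K W : Set (σ → K)) :=
  ⟨_, (zeroLocus_span_X W).symm⟩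

/-- Setting the variables in `W` to zero. -/
def restrictHom (k : Type*) {σ : Type*} [Field k] (W : Set σ) :
    MvPolynomial σ k →ₐ[k] MvPolynomial (Wᶜ : Set σ) k :=
  killCompl (f := Subtype.val) Subtype.val_injective

theorem restrictHom_X_of_mem {W : Set σ} {i : σ} (hi : i ∈ W) :
    restrictHom k W (X i) = 0 := by
  simp [restrictHom, killCompl, hi]

theorem restrictHom_X_coe {W : Set σ} (i : (Wᶜ : Set σ)) :
    restrictHom k W (X (i : σ)) = X i := by
  have h := killCompl_rename_app (R := k) (f := ((↑) : (Wᶜ : Set σ) → σ))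
    Subtype.val_injective (X i)
  rwa [rename_X] at h

theorem restrictHom_surjective (W : Set σ) : Function.Surjective (restrictHom k W) := fun f =>
  ⟨rename Subtype.val f, killCompl_rename_app _ f⟩

theorem aeval_restrictHom {W : Set σ} {v : σ → K} (hv : v ∈ coordSubspace K W)
    (f : MvPolynomial σ k) :
    aeval (fun i : (Wᶜ : Set σ) => v i) (restrictHom k W f) = aeval v f := by
  rw [← AlgHom.comp_apply]
  congr 1
  ext i
  by_cases hi : i ∈ W
  · simp [restrictHom_X_of_mem hi, hv i hi]
  · simp [restrictHom_X_coe (⟨i, hi⟩ : (Wᶜ : Set σ))]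

theorem eq_zero_of_aeval_eq_zero [Infinite K] {f : MvPolynomial σ k}
    (h : ∀ v : σ → K, aeval v f = 0) : f = 0 := by
  apply map_injective (algebraMap k K) (algebraMap k K).injective
  rw [map_zero]
  refine MvPolynomial.funext fun v => ?_
  rw [eval_map, map_zero, ← aeval_def, h]

/-- The restricted polynomial is a function of the free coordinates alone, and these take all
values; over an infinite `K` it vanishes as a function only if it is zero. -/
theorem mem_vanishingIdeal_coordSubspace [Infinite K] {W : Set σ} {f : MvPolynomial σ k} :
    f ∈ vanishingIdeal k (coordSubspace K W : Set (σ → K)) ↔ restrictHom k W f = 0 := by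
  refine ⟨fun h => eq_zero_of_aeval_eq_zero (K := K) fun y => ?_, fun h v hv => ?_⟩
  · have hy := aeval_restrictHom ((coordSubspaceEquiv K W).symm y).2 f
    rw [h _ ((coordSubspaceEquiv K W).symm y).2] at hy
    rw [← hy]
    congr 2
    exact ((coordSubspaceEquiv K W).apply_symm_apply y).symm
  · rw [← aeval_restrictHom hv, h, map_zero]

theorem vanishingIdeal_coordSubspace [Infinite K] (W : Set σ) :
    vanishingIdeal k (coordSubspace K W : Set (σ → K)) = RingHom.ker (restrictHom k W) := by
  ext f
  rw [mem_vanishingIdeal_coordSubspace, RingHom.mem_ker]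

theorem isPrime_vanishingIdeal_coordSubspace [Infinite K] (W : Set σ) :
    (vanishingIdeal k (coordSubspace K W : Set (σ → K))).IsPrime := by
  rw [vanishingIdeal_coordSubspace]
  exact RingHom.ker_isPrime _

theorem X_mem_vanishingIdeal_coordSubspace_iff {W : Set σ} {i : σ} :
    (X i : MvPolynomial σ k) ∈ vanishingIdeal k (coordSubspace K W : Set (σ → K)) ↔ i ∈ W := by
  rw [← Set.singleton_subset_iff, ← coordSubspace_le_iff (K := K)]
  simp [SetLike.le_def, mem_coordSubspace]

theorem varietyDim_coordSubspace [Infinite K] [Finite σ] (W : Set σ) :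
    varietyDim k (coordSubspace K W : Set (σ → K)) =
      (Module.finrank K (coordSubspace K W) : WithBot ℕ∞) := by
  rw [varietyDim, vanishingIdeal_coordSubspace, finrank_coordSubspace,
    ringKrullDim_eq_of_ringEquiv (Ideal.quotientKerAlgEquivOfSurjective
      (restrictHom_surjective (k := k) W)).toRingEquiv,
    MvPolynomial.ringKrullDim_of_isNoetherianRing, ringKrullDim_eq_zero_of_field, zero_add]

theorem restrictHom_pderiv (W : Set σ) (i : (Wᶜ : Set σ)) (f : MvPolynomial σ k) :
    restrictHom k W (pderiv (i : σ) f) = pderiv i (restrictHom k W f) := by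
  classical
  induction f using MvPolynomial.induction_on with
  | C a => simp [restrictHom]
  | add f g hf hg => simp [hf, hg]
  | mul_X f j hf =>
    simp only [Derivation.leibniz, map_add, map_mul, smul_eq_mul, hf, pderiv_X]
    by_cases hj : j ∈ W
    · have : j ≠ i := by rintro rfl; exact i.2 hj
      simp [restrictHom_X_of_mem hj, Pi.single_eq_of_ne this]
    · lift j to (Wᶜ : Set σ) using hj
      rw [restrictHom_X_coe, pderiv_X]
      by_cases hij : j = i
      · subst hij; simp
      · have : (j : σ) ≠ i := fun h => hij (Subtype.ext h)
        simp [Pi.single_eq_of_ne this, Pi.single_eq_of_ne hij]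

/-- A polynomial vanishing on the subspace restricts to zero, and derivatives in the free variables
commute with restriction; the other terms of the differential are multiplied by `v i = 0`. -/
theorem coordSubspace_le_tangentSpace [Infinite K] [Fintype σ] {X : Set (σ → K)} {W : Set σ}
    (hWX : (coordSubspace K W : Set (σ → K)) ⊆ X) {p : σ → K} (hp : p ∈ coordSubspace K W) :
    coordSubspace K W ≤ tangentSpace k X p := by
  intro v hv f hf
  refine Finset.sum_eq_zero fun i _ => ?_
  by_cases hi : i ∈ W
  · rw [hv i hi, mul_zero]
  · have hf' := mem_vanishingIdeal_coordSubspace.1 (vanishingIdeal_anti_mono hWX hf)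
    rw [← aeval_restrictHom hp, restrictHom_pderiv W ⟨i, hi⟩, hf', map_zero, map_zero, zero_mul]

end CoordSubspace

/-! ### Irreducible varieties -/

section Irreducible

variable {k K σ : Type*} [Field k] [Field K] [Algebra k K]

theorem IsVariety.zeroLocus_vanishingIdeal {Z : Set (σ → K)} (hZ : IsVariety k Z) :
    zeroLocus K (vanishingIdeal k Z) = Z := by
  obtain ⟨I, rfl⟩ := hZ
  exact (zeroLocus_anti_mono (le_vanishingIdeal_zeroLocus I)).antisymm
    (zeroLocus_vanishingIdeal_le _)

theorem isIrreducibleVariety_of_isPrime {Z : Set (σ → K)} (hZ : IsVariety k Z)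
    (hP : (vanishingIdeal k Z).IsPrime) : IsIrreducibleVariety k Z := by
  refine ⟨hZ, ?_, fun Z₁ Z₂ h₁ h₂ h => ?_⟩
  · by_contra hne
    rw [Set.not_nonempty_iff_eq_empty] at hne
    exact hP.ne_top (hne ▸ vanishingIdeal_empty)
  · have hle : vanishingIdeal k Z₁ * vanishingIdeal k Z₂ ≤ vanishingIdeal k Z := by
      refine Ideal.mul_le.2 fun f hf g hg x hx => ?_
      rw [map_mul]
      rcases (h ▸ hx : x ∈ Z₁ ∪ Z₂) with hx | hx
      · rw [hf x hx, zero_mul]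
      · rw [hg x hx, mul_zero]
    have key : ∀ Z' : Set (σ → K), IsVariety k Z' → vanishingIdeal k Z' ≤ vanishingIdeal k Z →
        Z ⊆ Z' := fun Z' h' hle' => by
      rw [← hZ.zeroLocus_vanishingIdeal, ← h'.zeroLocus_vanishingIdeal]
      exact zeroLocus_anti_mono hle'
    refine (hP.mul_le.1 hle).imp (fun h' => ?_) (fun h' => ?_)
    · exact (key _ h₁ h').antisymm (h ▸ Set.subset_union_left)
    · exact (key _ h₂ h').antisymm (h ▸ Set.subset_union_right)

theorem IsIrreducibleVariety.isPrime_vanishingIdeal {Z : Set (σ → K)}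
    (hZ : IsIrreducibleVariety k Z) : (vanishingIdeal k Z).IsPrime := by
  obtain ⟨hV, ⟨x, hx⟩, hirr⟩ := hZ
  -- If `f * g` vanishes on `Z`, the cuts of `Z` by `f = 0` and `g = 0` cover `Z`, so irreducibility
  -- applies to them.
  have hcut : ∀ f : MvPolynomial σ k, IsVariety k (Z ∩ {x | aeval x f = 0}) := fun f => by
    refine ⟨Ideal.span (vanishingIdeal k Z ∪ {f}), ?_⟩
    ext y
    rw [zeroLocus_span]
    nth_rw 1 [← hV.zeroLocus_vanishingIdeal]
    simp [or_imp, forall_and, and_comm]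
  refine ⟨fun h => ?_, fun {f g} hfg => ?_⟩
  · have h1 : (1 : MvPolynomial σ k) ∈ vanishingIdeal k Z := h ▸ Submodule.mem_top
    simpa using h1 x hx
  · refine (hirr _ _ (hcut f) (hcut g) ?_).imp (fun h y hy => ?_) (fun h y hy => ?_)
    · rw [← Set.inter_union_distrib_left, eq_comm, Set.inter_eq_left]
      intro y hy
      have := hfg y hy
      rwa [map_mul, mul_eq_zero] at this
    · exact (h ▸ hy : y ∈ Z ∩ _).2
    · exact (h ▸ hy : y ∈ Z ∩ _).2

end Irreducible

/-! ### The variety of an edge ideal -/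

section EdgeVariety

variable {k K V : Type*} [Field k] [Field K] [Algebra k K] {G : SimpleGraph V}

theorem exists_minimal_isVertexCover_subset [Finite V] {W : Set V} (hW : G.IsVertexCover W) :
    ∃ W' ⊆ W, Minimal G.IsVertexCover W' :=
  exists_minimal_le_of_wellFoundedLT _ W hW

theorem exists_adj_notMem_of_minimal {W : Set V} (hW : Minimal G.IsVertexCover W) {i : V}
    (hi : i ∈ W) : ∃ j ∉ W, G.Adj i j := by
  by_contra! h
  have hcov : G.IsVertexCover (W \ {i}) := by
    intro a b hab
    have h1 := hW.prop hab
    have hne := hab.ne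
    by_cases ha : a = i
    · subst ha
      exact Or.inr ⟨by_contra fun hb => h b hb hab, hne.symm⟩
    by_cases hb : b = i
    · subst hb
      exact Or.inl ⟨by_contra fun ha' => h a ha' hab.symm, hne⟩
    exact h1.imp (fun h => ⟨h, ha⟩) (fun h => ⟨h, hb⟩)
  exact (hW.le_of_le hcov Set.sdiff_subset hi).2 rfl

theorem mem_zeroLocus_edgeIdeal {p : V → K} :
    p ∈ zeroLocus K (edgeIdeal k G) ↔ ∀ x y, G.Adj x y → p x * p y = 0 := by
  rw [edgeIdeal, zeroLocus_span]
  refine ⟨fun h x y hxy => by simpa using h _ ⟨x, y, hxy, rfl⟩, ?_⟩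
  rintro h _ ⟨x, y, hxy, rfl⟩
  simpa using h x y hxy

theorem mem_zeroLocus_edgeIdeal_iff_isVertexCover {p : V → K} :
    p ∈ zeroLocus K (edgeIdeal k G) ↔ G.IsVertexCover {i | p i = 0} := by
  rw [mem_zeroLocus_edgeIdeal]
  simp only [mul_eq_zero]
  exact Iff.rfl

theorem coordSubspace_subset_zeroLocus_edgeIdeal {W : Set V} (hW : G.IsVertexCover W) :
    (coordSubspace K W : Set (V → K)) ⊆ zeroLocus K (edgeIdeal k G) := fun _ hp =>
  mem_zeroLocus_edgeIdeal_iff_isVertexCover.2 (hW.subset hp)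

/-- The vanishing ideal of `F` is prime and contains each edge monomial, so the variables in it form
a vertex cover. -/
theorem exists_subset_coordSubspace [Finite V] {F : Set (V → K)}
    (hF : IsIrreducibleVariety k F) (hFX : F ⊆ zeroLocus K (edgeIdeal k G)) :
    ∃ W, Minimal G.IsVertexCover W ∧ F ⊆ coordSubspace K W := by
  have hcov : G.IsVertexCover {i | (X i : MvPolynomial V k) ∈ vanishingIdeal k F} := by
    intro i j hij
    refine hF.isPrime_vanishingIdeal.mem_or_mem fun p hp => ?_
    simpa using mem_zeroLocus_edgeIdeal.1 (hFX hp) i j hij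
  obtain ⟨W, hsub, hW⟩ := exists_minimal_isVertexCover_subset hcov
  exact ⟨W, hW, fun p hp i hi => by simpa using hsub hi p hp⟩

theorem isIrreducibleVariety_coordSubspace [Infinite K] (W : Set V) :
    IsIrreducibleVariety k (coordSubspace K W : Set (V → K)) :=
  isIrreducibleVariety_of_isPrime (isVariety_coordSubspace W)
    (isPrime_vanishingIdeal_coordSubspace W)

theorem isComponent_zeroLocus_edgeIdeal_iff [Finite V] [Infinite K] {F : Set (V → K)} :
    IsComponent k (zeroLocus K (edgeIdeal k G)) F ↔
      ∃ W, Minimal G.IsVertexCover W ∧ F = coordSubspace K W := by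
  constructor
  · intro hF
    obtain ⟨W, hW, hsub⟩ := exists_subset_coordSubspace hF.prop.1 hF.prop.2
    exact ⟨W, hW, hF.eq_of_subset ⟨isIrreducibleVariety_coordSubspace W,
      coordSubspace_subset_zeroLocus_edgeIdeal hW.prop⟩ hsub⟩
  · rintro ⟨W, hW, rfl⟩
    refine ⟨⟨isIrreducibleVariety_coordSubspace W,
      coordSubspace_subset_zeroLocus_edgeIdeal hW.prop⟩, fun F hF hle => ?_⟩
    obtain ⟨W', hW', hsub⟩ := exists_subset_coordSubspace hF.1 hF.2
    have h1 : W' ⊆ W := coordSubspace_le_iff.1 (hle.trans hsub)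
    rwa [hW.eq_of_subset hW'.prop h1] at hsub

theorem dimAt_zeroLocus_edgeIdeal [Finite V] [Infinite K] (p : V → K) :
    dimAt k (zeroLocus K (edgeIdeal k G)) p =
      ⨆ W ∈ {W : Set V | Minimal G.IsVertexCover W ∧ p ∈ coordSubspace K W},
        (Module.finrank K (coordSubspace K W) : WithBot ℕ∞) := by
  refine le_antisymm (iSup₂_le ?_) (iSup₂_le ?_)
  · rintro F ⟨hF, hp⟩
    obtain ⟨W, hW, rfl⟩ := isComponent_zeroLocus_edgeIdeal_iff.1 hF
    rw [varietyDim_coordSubspace]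
    exact le_iSup₂ (f := fun (W : Set V) (_ : W ∈ {W : Set V | Minimal G.IsVertexCover W ∧
      p ∈ coordSubspace K W}) => (Module.finrank K (coordSubspace K W) : WithBot ℕ∞)) W ⟨hW, hp⟩
  · rintro W ⟨hW, hp⟩
    rw [← varietyDim_coordSubspace (k := k)]
    exact le_iSup₂ (f := fun (F : Set (V → K)) (_ : F ∈ {F : Set (V → K) |
      IsComponent k (zeroLocus K (edgeIdeal k G)) F ∧ p ∈ F}) => varietyDim k F) _
      ⟨isComponent_zeroLocus_edgeIdeal_iff.2 ⟨W, hW, rfl⟩, hp⟩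

theorem exists_dimAt_eq_finrank [Finite V] [Infinite K] {p : V → K}
    (hp : p ∈ zeroLocus K (edgeIdeal k G)) :
    ∃ W, Minimal G.IsVertexCover W ∧ p ∈ coordSubspace K W ∧
      dimAt k (zeroLocus K (edgeIdeal k G)) p =
        (Module.finrank K (coordSubspace K W) : WithBot ℕ∞) := by
  obtain ⟨W₀, hsub, hW₀⟩ := exists_minimal_isVertexCover_subset
    (mem_zeroLocus_edgeIdeal_iff_isVertexCover.1 hp)
  obtain ⟨W, hW, hmax⟩ := Set.exists_max_image
    {W : Set V | Minimal G.IsVertexCover W ∧ p ∈ coordSubspace K W}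
    (fun W => Module.finrank K (coordSubspace K W)) (Set.toFinite _)
    ⟨W₀, hW₀, fun i hi => hsub hi⟩
  refine ⟨W, hW.1, hW.2, ?_⟩
  rw [dimAt_zeroLocus_edgeIdeal]
  refine le_antisymm (iSup₂_le fun W' hW' => ?_) ?_
  · exact_mod_cast hmax W' hW'
  · exact le_iSup₂ (f := fun (W : Set V) (_ : W ∈ {W : Set V | Minimal G.IsVertexCover W ∧
      p ∈ coordSubspace K W}) => (Module.finrank K (coordSubspace K W) : WithBot ℕ∞)) W hW

/-- A point of the variety of `G` whose zero coordinates are those of a minimal vertex cover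
is smooth. -/
theorem mem_smoothLocus_of_minimal [Fintype V] [Infinite K] {p : V → K}
    (hp : Minimal G.IsVertexCover {i | p i = 0}) :
    p ∈ smoothLocus k (zeroLocus K (edgeIdeal k G)) := by
  have hpX : p ∈ zeroLocus K (edgeIdeal k G) :=
    mem_zeroLocus_edgeIdeal_iff_isVertexCover.2 hp.prop
  refine ⟨hpX, ?_⟩
  obtain ⟨W, hW, hpW, hdim⟩ := exists_dimAt_eq_finrank hpX
  have hWp : {i | p i = 0} = W := (hp.eq_of_subset hW.prop hpW).symm
  have hT : tangentSpace k (zeroLocus K (edgeIdeal k G)) p = coordSubspace K W := by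
    refine le_antisymm (fun v hv i hi => ?_)
      (coordSubspace_le_tangentSpace (coordSubspace_subset_zeroLocus_edgeIdeal hW.prop) hpW)
    obtain ⟨j, hj, hij⟩ := exists_adj_notMem_of_minimal hW hi
    -- As `p i = 0`, the differential of this edge monomial at `p` is `p j * v i`, with `p j ≠ 0`.
    have hmem : (X i * X j : MvPolynomial V k) ∈
        vanishingIdeal k (zeroLocus K (edgeIdeal k G)) := fun q hq => by
      simpa using mem_zeroLocus_edgeIdeal.1 hq i j hij
    have hsum := hv _ hmem
    have hpi : p i = 0 := hpW i hi
    have hpj : p j ≠ 0 := fun h => hj (hWp ▸ h)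
    classical
    simpa [pderiv_X, Pi.single_apply, hpi, hpj, apply_ite (aeval p)] using hsum
  rw [hT, hdim]

/-- At a smooth point there is a minimal vertex cover each of whose vertices has a neighbour
at which the point does not vanish. -/
theorem exists_minimal_of_mem_smoothLocus [Fintype V] [Infinite K] {p : V → K}
    (hp : p ∈ smoothLocus k (zeroLocus K (edgeIdeal k G))) :
    ∃ W, Minimal G.IsVertexCover W ∧ ∀ i ∈ W, ∃ j, G.Adj i j ∧ p j ≠ 0 := by
  obtain ⟨hpX, hdim⟩ := hp
  obtain ⟨W, hW, hpW, hdim'⟩ := exists_dimAt_eq_finrank hpX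
  have hT : coordSubspace K W = tangentSpace k (zeroLocus K (edgeIdeal k G)) p := by
    refine Submodule.eq_of_le_of_finrank_eq (coordSubspace_le_tangentSpace
      (coordSubspace_subset_zeroLocus_edgeIdeal hW.prop) hpW) ?_
    rw [hdim'] at hdim
    exact_mod_cast hdim.symm
  refine ⟨W, hW, fun i hi => ?_⟩
  by_contra! h
  -- With all neighbours of `i` zero at `p`, the vertex `i` is not needed to cover. This gives a
  -- component through `p` on which `x_i` is free, yet it lies in the tangent space, where `v i =
  -- 0`.
  have hcov : G.IsVertexCover ({i | p i = 0} \ {i}) := by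
    intro a b hab
    have hne := hab.ne
    by_cases ha : a = i
    · subst ha
      exact Or.inr ⟨h b hab, hne.symm⟩
    by_cases hb : b = i
    · subst hb
      exact Or.inl ⟨h a hab.symm, hne⟩
    exact (mem_zeroLocus_edgeIdeal_iff_isVertexCover.1 hpX hab).imp
      (fun h => ⟨h, ha⟩) (fun h => ⟨h, hb⟩)
  obtain ⟨W', hsub, hW'⟩ := exists_minimal_isVertexCover_subset hcov
  have hle : coordSubspace K W' ≤ coordSubspace K W := by
    rw [hT]
    exact coordSubspace_le_tangentSpace (coordSubspace_subset_zeroLocus_edgeIdeal hW'.prop)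
      fun j hj => (hsub hj).1
  exact (hsub (coordSubspace_le_iff.1 hle hi)).2 rfl

end EdgeVariety

/-! ### Jets of the variety of an edge ideal -/

section Jets

variable {k K V : Type*} [Field k] [Field K] [Algebra k K] {G : SimpleGraph V} {s : ℕ}

/-- The truncated power series of the coordinate `i` of a jet. -/
def jetSeries (P : V × Fin (s + 1) → K) (i : V) : Polynomial K :=
  ∑ l : Fin (s + 1), Polynomial.monomial (l : ℕ) (P (i, l))

theorem coeff_jetSeries (P : V × Fin (s + 1) → K) (i : V) (l : Fin (s + 1)) :
    (jetSeries P i).coeff l = P (i, l) := by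
  simp [jetSeries, Polynomial.finsetSum_coeff, Polynomial.coeff_monomial, Fin.val_inj]

/-- Turns the jet equations at `P` into identities between truncated series over `K`; both sides
come from algebra homomorphisms that agree on the variables. -/
theorem aeval_coeff_jetHom (P : V × Fin (s + 1) → K) (f : MvPolynomial V k) (n : ℕ) :
    aeval P ((jetHom k V s f).coeff n) = (aeval (jetSeries P) f).coeff n := by
  have h : ((Polynomial.mapAlgHom (aeval P)).comp (jetHom k V s)) =
      (aeval (jetSeries P) : MvPolynomial V k →ₐ[k] Polynomial K) := by
    ext1 i
    simp [jetHom, jetSeries, Polynomial.map_sum, Polynomial.mapAlgHom]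
  rw [← h]
  simp [Polynomial.mapAlgHom]

theorem mem_zeroLocus_span_jetVars {W : Set V} {P : V × Fin (s + 1) → K} :
    P ∈ zeroLocus K (Ideal.span (jetVars k s W)) ↔ ∀ i ∈ W, ∀ l, P (i, l) = 0 := by
  rw [zeroLocus_span]
  refine ⟨fun h i hi l => by simpa using h _ ⟨i, hi, l, rfl⟩, ?_⟩
  rintro h _ ⟨i, hi, l, rfl⟩
  simpa using h i hi l

theorem mem_zeroLocus_jetIdeal {I : Ideal (MvPolynomial V k)} {P : V × Fin (s + 1) → K} :
    P ∈ zeroLocus K (jetIdeal s I) ↔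
      ∀ f ∈ I, ∀ l : Fin (s + 1), (aeval (jetSeries P) f).coeff (l : ℕ) = 0 := by
  rw [jetIdeal, zeroLocus_span]
  refine ⟨fun h f hf l => ?_, ?_⟩
  · rw [← aeval_coeff_jetHom]
    exact h _ ⟨f, hf, l, rfl⟩
  · rintro h _ ⟨f, hf, l, rfl⟩
    rw [aeval_coeff_jetHom]
    exact h f hf l

theorem zeroLocus_span_jetVars_subset_zeroLocus_jetIdeal {W : Set V} (hW : G.IsVertexCover W) :
    zeroLocus K (Ideal.span (jetVars k s W)) ⊆ zeroLocus K (jetIdeal s (edgeIdeal k G)) := by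
  intro P hP
  rw [mem_zeroLocus_span_jetVars] at hP
  rw [mem_zeroLocus_jetIdeal]
  have h0 : ∀ i ∈ W, jetSeries P i = 0 := fun i hi => by simp [jetSeries, hP i hi]
  have hle : edgeIdeal k G ≤ RingHom.ker (aeval (R := k) (jetSeries P)) := by
    refine Ideal.span_le.2 ?_
    rintro _ ⟨x, y, hxy, rfl⟩
    rcases hW hxy with h | h <;> simp [h0 _ h]
  intro f hf l
  rw [(RingHom.mem_ker).1 (hle hf), Polynomial.coeff_zero]

/-- If the jets `a` and `b` multiply to zero modulo `t ^ (s + 1)` and `b` has a nonzero constant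
term, then `a` is zero modulo `t ^ (s + 1)`. -/
theorem coeff_eq_zero_of_coeff_mul_eq_zero {a b : Polynomial K} (hb : b.coeff 0 ≠ 0)
    (h : ∀ l ≤ s, (a * b).coeff l = 0) {l : ℕ} (hl : l ≤ s) : a.coeff l = 0 := by
  have hdvd : Polynomial.X ^ (s + 1) ∣ a * b :=
    Polynomial.X_pow_dvd_iff.2 fun l hl => h l (Nat.lt_succ_iff.1 hl)
  have hX : ¬ Polynomial.X ∣ b := by rwa [Polynomial.X_dvd_iff]
  have := Polynomial.prime_X.pow_dvd_of_dvd_mul_right (s + 1) hX hdvd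
  exact Polynomial.X_pow_dvd_iff.1 this l (Nat.lt_succ_of_le hl)

theorem jetsOfOpen_smoothLocus_subset [Fintype V] [Infinite K] :
    jetsOfOpen s (edgeIdeal k G) (smoothLocus k (zeroLocus K (edgeIdeal k G))) ⊆
      ⋃ W ∈ {W : Set V | Minimal G.IsVertexCover W},
        zeroLocus K (Ideal.span (jetVars k s W)) := by
  rintro P ⟨hP, hsm⟩
  obtain ⟨W, hW, hadj⟩ := exists_minimal_of_mem_smoothLocus hsm
  refine Set.mem_biUnion hW (mem_zeroLocus_span_jetVars.2 fun i hi l => ?_)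
  obtain ⟨j, hij, hj⟩ := hadj i hi
  rw [← coeff_jetSeries P i l]
  have hj0 : (jetSeries P j).coeff 0 ≠ 0 := by
    have := coeff_jetSeries P j 0
    rw [Fin.val_zero] at this
    rwa [this]
  refine coeff_eq_zero_of_coeff_mul_eq_zero (s := s) hj0 (fun l hl => ?_)
    (Nat.lt_succ_iff.1 l.2)
  have := mem_zeroLocus_jetIdeal.1 hP (X i * X j) (Ideal.subset_span ⟨i, j, hij, rfl⟩)
    ⟨l, Nat.lt_succ_of_le hl⟩
  simpa using this

theorem zariskiClosure_mono {σ : Type*} {S T : Set (σ → K)} (h : S ⊆ T) :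
    zariskiClosure k S ⊆ zariskiClosure k T :=
  zeroLocus_anti_mono (vanishingIdeal_anti_mono h)

/-- A finite union of zero sets is Zariski closed. -/
theorem zariskiClosure_biUnion_zeroLocus {σ ι : Type*} {t : Set ι} (ht : t.Finite)
    (I : ι → Ideal (MvPolynomial σ k)) :
    zariskiClosure k (⋃ i ∈ t, zeroLocus K (I i)) = ⋃ i ∈ t, zeroLocus K (I i) := by
  refine Set.Subset.antisymm (fun x hx => ?_) (zeroLocus_vanishingIdeal_le _)
  by_contra hne
  simp only [Set.mem_iUnion, mem_zeroLocus_iff, not_exists, not_forall] at hne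
  -- A product of one polynomial from each ideal, none vanishing at `x`, separates `x` from the
  -- union.
  choose! f hf hfx using hne
  have hprod : ∏ i ∈ ht.toFinset, f i ∈ vanishingIdeal k (⋃ i ∈ t, zeroLocus K (I i)) := by
    intro y hy
    simp only [Set.mem_iUnion] at hy
    obtain ⟨i, hi, hy⟩ := hy
    rw [map_prod]
    exact Finset.prod_eq_zero (ht.mem_toFinset.2 hi) (hy _ (hf i hi))
  have := hx _ hprod
  rw [map_prod, Finset.prod_eq_zero_iff] at this
  obtain ⟨i, hi, h0⟩ := this
  exact hfx i (ht.mem_toFinset.1 hi) h0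

theorem zeroLocus_span_jetVars (W : Set V) :
    zeroLocus K (Ideal.span (jetVars k s W)) =
      coordSubspace K {a : V × Fin (s + 1) | a.1 ∈ W} := by
  ext P
  rw [mem_zeroLocus_span_jetVars, SetLike.mem_coe, mem_coordSubspace]
  exact ⟨fun h a ha => h a.1 ha a.2, fun h i hi l => h (i, l) hi⟩

theorem zeroLocus_span_jetVars_subset_principalComponent [Fintype V] [Infinite K] {W : Set V}
    (hW : Minimal G.IsVertexCover W) :
    zeroLocus K (Ideal.span (jetVars k s W)) ⊆ principalComponent k K s G := by
  classical
  set L : Set (V × Fin (s + 1) → K) := zeroLocus K (Ideal.span (jetVars k s W)) with hL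
  refine (zeroLocus_vanishingIdeal_le L).trans (zeroLocus_anti_mono fun f hf => ?_)
  have hprime : (vanishingIdeal k L).IsPrime := by
    rw [hL, zeroLocus_span_jetVars]
    exact isPrime_vanishingIdeal_coordSubspace _
  -- The product vanishes at the jets whose base point has a zero outside `W`; at the others the
  -- base point is smooth, so `f` vanishes. Primality then removes the product, since no factor
  -- vanishes on all of `L`.
  have hmul : f * ∏ i ∈ {i | i ∉ W}, X (i, 0) ∈ vanishingIdeal k L := by
    intro P hP
    rw [map_mul, mul_eq_zero, or_iff_not_imp_right]
    intro hne
    refine hf P ⟨zeroLocus_span_jetVars_subset_zeroLocus_jetIdeal hW.prop hP,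
      mem_smoothLocus_of_minimal ?_⟩
    have hzero : {i | jetProj s P i = 0} = W := by
      ext i
      refine ⟨fun hi => ?_, fun hi => mem_zeroLocus_span_jetVars.1 hP i hi 0⟩
      by_contra hiW
      refine hne ?_
      rw [map_prod]
      exact Finset.prod_eq_zero (i := i) (by simpa using hiW) (by simpa [jetProj] using hi)
    rwa [hzero]
  refine (hprime.mem_or_mem hmul).resolve_right fun h => ?_
  obtain ⟨i, hi, hmem⟩ := hprime.prod_mem_iff.1 h
  rw [hL, zeroLocus_span_jetVars, X_mem_vanishingIdeal_coordSubspace_iff] at hmem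
  exact (Finset.mem_filter.1 hi).2 hmem

end Jets

end GraphJets

end

theorem mainTheorem1 {k K V : Type*} [Field k] [Field K] [Algebra k K] [Infinite K] [Fintype V]
    (G : SimpleGraph V) (s : ℕ) :
    GraphJets.principalComponent k K s G =
      ⋃ W ∈ {W : Set V | Minimal G.IsVertexCover W},
        MvPolynomial.zeroLocus K (Ideal.span (GraphJets.jetVars k s W)) := by
  refine Set.Subset.antisymm ?_ (Set.iUnion₂_subset fun W hW =>
    GraphJets.zeroLocus_span_jetVars_subset_principalComponent hW)
  refine (GraphJets.zariskiClosure_mono GraphJets.jetsOfOpen_smoothLocus_subset).trans ?_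
  exact (GraphJets.zariskiClosure_biUnion_zeroLocus (Set.toFinite _) _).subset
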